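/- A quantum graph $G$ is a pair consisting of a finite-dimensional complex inner product space $V(G)$ and a real vector space $E(G)$ of self-adjoint operators on $V(G)$ containing the identity $I$. Its order is $|G|=\dim_{\mathbb C}V(G)$ and its valence is $\|G\|=\dim_{\mathbb R}E(G)-1$. A code of $G$ is a subspace $C\subseteq V(G)$ for which there is a function $\epsilon_C:E(G)\to\mathbb R$ with $P_CAP_C=\epsilon_C(A)P_C$ for all $A\in E(G)$, where $P_C$ is the orthogonal projection onto $C$. A coloring of $G$ is a set $K$ of codes of $G$ with $\sum_{C\in K}P_C=I$, and the chromatic number $\chi(G)$ is the least cardinality of a coloring of $G$. For integers $n,m\ge 0$ with $m+1\le n^2$ (so that quantum graphs of order $n$ and valence $m$ exist), let $\chi(n,m)$ be the maximum of $\chi(G)$ over all quantum graphs $G$ with $|G|=n$ and $\|G\|=m$. Define the step logarithm by $\operatorname{slog}(0,q)=0$ and $\operatorname{slog}(p,q)=\operatorname{slog}(p-\lceil p/q\rceil,q)+1$ for positive integers $p,q$. Theorem. For all integers $n,m\ge 0$ with $m+1\le n^2$, the maximum $\chi(n,m)$ exists and $$\operatorname{slog}(n,m+1)\le\chi(n,m)\le\operatorname{slog}(n,(m+1)^2).$$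 Moreover, for every $m\ge1$, $\operatorname{slog}(n,m+1)\to\infty$ as $n\to\infty$, and there are quantum graphs of valence $m$ with arbitrarily large chromatic number. In particular, there is no function $f:\mathbb N\to\mathbb N$ such that $\chi(G)\le f(\|G\|)$ for all quantum graphs $G$. -/

import Mathlib

universe u

noncomputable section

/-- A quantum graph: a finite-dimensional complex inner product space `V` (the vertex space) with a
real vector space `E` of self-adjoint operators on `V` (the edge space) that contains the
identity. -/
structure QuantumGraph where
  V : Type u
  [normedAddCommGroup : NormedAddCommGroup V]
  [innerProductSpace : InnerProductSpace ℂ V]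
  [finiteDimensional : FiniteDimensional ℂ V]
  E : Submodule ℝ (V →ₗ[ℂ] V)
  isSymmetric : ∀ A ∈ E, A.IsSymmetric
  one_mem : (1 : V →ₗ[ℂ] V) ∈ E

namespace QuantumGraph

attribute [instance] normedAddCommGroup innerProductSpace finiteDimensional

/-- The order: the dimension of the vertex space. -/
def order (G : QuantumGraph.{u}) : ℕ := Module.finrank ℂ G.V

/-- The valence: the (real) dimension of the edge space minus one. The subtraction is genuine as
soon as `V` is not the zero space, since then the identity is a nonzero element of `E`. -/
def valence (G : QuantumGraph.{u}) : ℕ := Module.finrank ℝ G.E - 1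

/-- The orthogonal projection of the vertex space onto a subspace `C`, as an operator. -/
def proj (G : QuantumGraph.{u}) (C : Submodule ℂ G.V) : G.V →ₗ[ℂ] G.V :=
  (C.starProjection : G.V →ₗ[ℂ] G.V)

/-- `C` is a code: `P_C A P_C = ε(A) P_C` for all edges `A` and some real function `ε` on the
edge space. -/
def IsCode (G : QuantumGraph.{u}) (C : Submodule ℂ G.V) : Prop :=
  ∃ ε : G.E → ℝ, ∀ A : G.E,
    G.proj C * (A : G.V →ₗ[ℂ] G.V) * G.proj C = ε A • G.proj C

/-- `K` is a coloring: a set of codes whose projections sum to the identity. -/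
def IsColoring (G : QuantumGraph.{u}) (K : Finset (Submodule ℂ G.V)) : Prop :=
  (∀ C ∈ K, G.IsCode C) ∧ ∑ C ∈ K, G.proj C = 1

/-- The chromatic number: the least cardinality of a coloring (`⊤` if there were none). -/
def chromaticNumber (G : QuantumGraph.{u}) : ℕ∞ :=
  sInf {k : ℕ∞ | ∃ K : Finset (Submodule ℂ G.V), G.IsColoring K ∧ (K.card : ℕ∞) = k}

end QuantumGraph

/-- The chromatic numbers of all quantum graphs of order `n` and valence `m`. -/
def chromaticNumbers (n m : ℕ) : Set ℕ∞ :=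
  {k | ∃ G : QuantumGraph.{u}, G.order = n ∧ G.valence = m ∧ G.chromaticNumber = k}

/-- `χ(n, m)`: the maximum chromatic number among quantum graphs of order `n` and valence `m`. -/
def maxChromaticNumber (n m : ℕ) : ℕ∞ := sSup (chromaticNumbers.{u} n m)

end

/-- The step logarithm: `slog 0 q = 0` and `slog p q = slog (p - ⌈p / q⌉) q + 1` for positive
`p` and `q` (for `q = 0`, where it is not otherwise defined, it is set to `0`). -/
def slog (p q : ℕ) : ℕ :=
  if h : 0 < p ∧ 0 < q then slog (p - p ⌈/⌉ q) q + 1 else 0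
termination_by p
decreasing_by
  have h1 : 0 < p ⌈/⌉ q := by
    rw [Nat.ceilDiv_eq_add_pred_div]
    exact Nat.div_pos (by omega) h.2
  omega

/-- If `⟪z, q⟫ < ⟪z, z⟫`, then the segment from `z` to `q` has a point of norm smaller than `z`. -/
theorem exists_mem_segment_norm_lt {F : Type*} [NormedAddCommGroup F] [InnerProductSpace ℝ F]
    {z q : F} (h : inner ℝ z q < inner ℝ z z) : ∃ y ∈ segment ℝ z q, ‖y‖ < ‖z‖ := by
  have hseg : Convex ℝ (segment ℝ z q) := convex_segment z q
  by_contra! hmin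
  have hz : z ∈ segment ℝ z q := left_mem_segment ℝ z q
  have key : ‖0 - z‖ = ⨅ w : segment ℝ z q, ‖0 - (w : F)‖ := by
    have : Nonempty (segment ℝ z q) := ⟨⟨z, hz⟩⟩
    apply le_antisymm
    · exact le_ciInf fun w => by simpa using hmin w w.2
    · exact ciInf_le ⟨0, by rintro _ ⟨w, rfl⟩; positivity⟩ (⟨z, hz⟩ : segment ℝ z q)
  have := (norm_eq_iInf_iff_real_inner_le_zero hseg hz).1 key q (right_mem_segment ℝ z q)
  rw [zero_sub, inner_neg_left, inner_sub_right] at this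
  linarith

/-- If `z ≠ 0` is a convex combination of more than `finrank` points, all of them in the half-space
`⟪z, z⟫ ≤ ⟪z, ·⟫`, then one of the points can be left out. -/
theorem exists_mem_convexHull_image_compl {F : Type*} [NormedAddCommGroup F] [InnerProductSpace ℝ F]
    [FiniteDimensional ℝ F] {ι : Type*} [Fintype ι] (hι : Module.finrank ℝ F < Fintype.card ι)
    {f : ι → F} {z : F} (hz0 : z ≠ 0) (hz : z ∈ convexHull ℝ (Set.range f))
    (hf : ∀ i, inner ℝ z z ≤ inner ℝ z (f i)) : ∃ i, z ∈ convexHull ℝ (f '' {i}ᶜ) := by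
  classical
  obtain ⟨α, _, y, w, hy, hind, hw0, hw1, hwz⟩ := eq_pos_convex_span_of_mem_convexHull hz
  choose g hg using fun a => hy ⟨a, rfl⟩
  have hge : ∀ a, inner ℝ z z ≤ inner ℝ z (y a) := fun a => hg a ▸ hf (g a)
  have heq : ∀ a, inner ℝ z (y a) = inner ℝ z z := by
    have hsum : ∑ a, w a * (inner ℝ z (y a) - inner ℝ z z) = 0 := by
      have hzz : inner ℝ z z = ∑ a, w a * inner ℝ z (y a) := calc
        inner ℝ z z = inner ℝ z (∑ a, w a • y a) := by rw [hwz]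
        _ = ∑ a, w a * inner ℝ z (y a) := by simp only [inner_sum, real_inner_smul_right]
      simp only [mul_sub, Finset.sum_sub_distrib, ← Finset.sum_mul, hw1, one_mul]
      rw [← hzz, sub_self]
    intro a
    have := (Finset.sum_eq_zero_iff_of_nonneg
      (fun a _ => mul_nonneg (hw0 a).le (sub_nonneg.2 (hge a)))).1 hsum a (Finset.mem_univ a)
    rcases mul_eq_zero.1 this with h | h
    · exact absurd h (hw0 a).ne'
    · linarith
  have hcard : Fintype.card α < Fintype.card ι := by
    refine lt_of_le_of_lt ?_ hι
    by_contra! hlt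
    have hcard : Fintype.card α = Module.finrank ℝ F + 1 := by
      have := hind.card_le_finrank_succ
      have h2 := Submodule.finrank_le (vectorSpan ℝ (Set.range y))
      omega
    have htop := (hind.affineSpan_eq_top_iff_card_eq_finrank_add_one).2 hcard
    have hmem : (0 : F) ∈ affineSpan ℝ (Set.range y) := htop ▸ AffineSubspace.mem_top ℝ F 0
    obtain ⟨s, v, hv1, hv⟩ := eq_affineCombination_of_mem_affineSpan hmem
    rw [Finset.affineCombination_eq_linear_combination _ _ _ hv1] at hv
    have h0 : inner ℝ z (0 : F) = inner ℝ z z := by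
      rw [hv, inner_sum]
      simp only [real_inner_smul_right, heq, ← Finset.sum_mul, hv1, one_mul]
    rw [inner_zero_right] at h0
    exact hz0 (inner_self_eq_zero.1 h0.symm)
  obtain ⟨i, hi⟩ : ∃ i, i ∉ Set.range g := by
    by_contra! h
    exact absurd (Fintype.card_le_of_surjective g h) (not_le.2 hcard)
  refine ⟨i, ?_⟩
  rw [← hwz]
  refine (convex_convexHull ℝ _).sum_mem (fun a _ => (hw0 a).le) hw1 fun a _ =>
    subset_convexHull ℝ _ ⟨g a, ?_, hg a⟩
  rintro rfl
  exact hi ⟨a, rfl⟩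

/-- **Colorful Carathéodory theorem** for finite color classes. -/
theorem exists_zero_mem_convexHull_choice {F : Type*} [NormedAddCommGroup F]
    [InnerProductSpace ℝ F] [FiniteDimensional ℝ F] {ι κ : Type*} [Fintype ι] [Finite κ]
    (hι : Module.finrank ℝ F < Fintype.card ι) (p : ι → κ → F)
    (hp : ∀ i, (0 : F) ∈ convexHull ℝ (Set.range (p i))) :
    ∃ j : ι → κ, (0 : F) ∈ convexHull ℝ (Set.range fun i => p i (j i)) := by
  classical
  let S : Set F := ⋃ j : ι → κ, convexHull ℝ (Set.range fun i => p i (j i))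
  have hne : ∀ i, Nonempty κ := fun i => by
    obtain ⟨_, k, _⟩ := convexHull_nonempty_iff.1 ⟨_, hp i⟩
    exact ⟨k⟩
  have hSc : IsCompact S := isCompact_iUnion fun j =>
    (Set.finite_range _).isCompact_convexHull ℝ
  have hSne : S.Nonempty := by
    have : Nonempty ι := Fintype.card_pos_iff.1 (by omega)
    let j : ι → κ := fun i => (hne i).some
    obtain ⟨i⟩ := ‹Nonempty ι›
    exact ⟨p i (j i), Set.mem_iUnion.2 ⟨j, subset_convexHull ℝ _ ⟨i, rfl⟩⟩⟩
  obtain ⟨z, hzS, hzmin⟩ := hSc.exists_isMinOn hSne continuous_norm.continuousOn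
  obtain ⟨j, hj⟩ := Set.mem_iUnion.1 hzS
  have hmin : ∀ (j' : ι → κ) (q : F), z ∈ convexHull ℝ (Set.range fun i => p i (j' i)) →
      q ∈ convexHull ℝ (Set.range fun i => p i (j' i)) → inner ℝ z z ≤ inner ℝ z q := by
    intro j' q hz hq
    by_contra! hlt
    obtain ⟨y, hy, hyz⟩ := exists_mem_segment_norm_lt hlt
    have hyS : y ∈ S := Set.mem_iUnion.2 ⟨j', (convex_convexHull ℝ _).segment_subset hz hq hy⟩
    exact absurd (isMinOn_iff.1 hzmin y hyS) (not_le.2 hyz)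
  by_cases hz0 : z = 0
  · exact ⟨j, hz0 ▸ hj⟩
  exfalso
  obtain ⟨i, hi⟩ := exists_mem_convexHull_image_compl hι hz0 hj
    fun i => hmin j _ hj (subset_convexHull ℝ _ ⟨i, rfl⟩)
  obtain ⟨k, hk⟩ : ∃ k, inner ℝ z (p i k) ≤ 0 := by
    by_contra! hpos
    have hconv : Convex ℝ {x : F | 0 < inner ℝ z x} :=
      convex_halfSpace_gt (innerₛₗ ℝ z).isLinear 0
    have h0 : (0 : F) ∈ {x : F | 0 < inner ℝ z x} :=
      convexHull_min (by rintro _ ⟨k, rfl⟩; exact hpos k) hconv (hp i)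
    simp at h0
  have hz' : z ∈ convexHull ℝ (Set.range fun i' => p i' (Function.update j i k i')) := by
    refine convexHull_mono ?_ hi
    rintro _ ⟨i', hi', rfl⟩
    exact ⟨i', by simp [Function.update_of_ne hi']⟩
  have := hmin (Function.update j i k) (p i k) hz' (subset_convexHull ℝ _ ⟨i, by simp⟩)
  have hpos : 0 < inner ℝ z z := real_inner_self_pos.2 hz0
  linarith

/-- **Tverberg's theorem**, in homogeneous form. -/
theorem exists_tverberg_partition {ι β : Type*} [Fintype ι] [Fintype β] (r : ℕ)
    (h : r * Fintype.card β < Fintype.card ι) (y : ι → β → ℝ) :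
    ∃ (j : ι → Fin (r + 1)) (w : ι → ℝ) (c : β → ℝ), (∀ i, 0 ≤ w i) ∧ ∑ i, w i = 1 ∧
      ∀ s b, ∑ i, (if j i = s then w i * y i b else 0) = c b := by
  classical
  let a : Fin (r + 1) → Fin r → ℝ := fun s t =>
    (if s = t.castSucc then 1 else 0) - if s = Fin.last r then 1 else 0
  let p : ι → Fin (r + 1) → EuclideanSpace ℝ (Fin r × β) := fun i s =>
    WithLp.toLp 2 fun tb => a s tb.1 * y i tb.2
  have hp : ∀ i, (0 : EuclideanSpace ℝ (Fin r × β)) ∈ convexHull ℝ (Set.range (p i)) := by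
    intro i
    have h0 : (0 : EuclideanSpace ℝ (Fin r × β)) =
        ∑ s : Fin (r + 1), ((r + 1 : ℝ)⁻¹) • p i s := by
      ext tb
      simp [p, a, ← Finset.mul_sum, ← Finset.sum_mul]
    rw [h0]
    refine (convex_convexHull ℝ _).sum_mem (fun _ _ => by positivity) ?_
      fun s _ => subset_convexHull ℝ _ ⟨s, rfl⟩
    have : (r + 1 : ℝ) ≠ 0 := by positivity
    simp [this]
  obtain ⟨j, hj⟩ := exists_zero_mem_convexHull_choice (by simpa using h) p hp
  rw [convexHull_range_eq_exists_affineCombination] at hj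
  obtain ⟨S, w, hw0, hw1, hw⟩ := hj
  rw [Finset.affineCombination_eq_linear_combination _ _ _ hw1] at hw
  refine ⟨j, fun i => if i ∈ S then w i else 0,
    fun b => ∑ i, (if j i = Fin.last r then (if i ∈ S then w i else 0) * y i b else 0),
    fun i => ?_, by simpa using hw1, ?_⟩
  · dsimp only
    split_ifs with hi
    exacts [hw0 i hi, le_rfl]
  · intro s b
    refine Fin.lastCases rfl (fun t => ?_) s
    have htb := congrArg (fun v : EuclideanSpace ℝ (Fin r × β) => v (t, b)) hw
    simp only [p, a, WithLp.ofLp_sum, WithLp.ofLp_smul, Finset.sum_apply, Pi.smul_apply,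
      smul_eq_mul, WithLp.ofLp_zero, Pi.zero_apply] at htb
    rw [← sub_eq_zero, ← Finset.sum_sub_distrib, ← Finset.sum_subset (Finset.subset_univ S)]
    · refine Eq.trans ?_ htb
      refine Finset.sum_congr rfl fun i hi => ?_
      simp only [hi, if_true]
      split_ifs <;> ring
    · intro i _ hi
      simp [hi]

theorem sub_ceilDiv_mono {q : ℕ} (hq : 0 < q) : Monotone fun p : ℕ => p - p ⌈/⌉ q := by
  refine monotone_nat_of_le_succ fun p => ?_
  have h : (p + 1) ⌈/⌉ q ≤ p ⌈/⌉ q + 1 := by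
    rw [ceilDiv_le_iff_le_mul hq]
    have : p ≤ q * (p ⌈/⌉ q) := le_smul_ceilDiv hq
    nlinarith
  omega

theorem slog_zero (q : ℕ) : slog 0 q = 0 := by
  rw [slog]; simp

theorem slog_of_pos {p q : ℕ} (hp : 0 < p) (hq : 0 < q) :
    slog p q = slog (p - p ⌈/⌉ q) q + 1 := by
  rw [slog]; simp [hp, hq]

theorem ceilDiv_pos_of_pos {p q : ℕ} (hp : 0 < p) (hq : 0 < q) : 0 < p ⌈/⌉ q := by
  rw [Nat.ceilDiv_eq_add_pred_div]
  exact Nat.div_pos (by omega) hq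

theorem slog_mono {q : ℕ} (hq : 0 < q) : Monotone fun p => slog p q := by
  intro a b
  induction b using Nat.strong_induction_on generalizing a with
  | _ b ih =>
    intro hab
    dsimp only
    rcases Nat.eq_zero_or_pos a with rfl | ha
    · simp [slog_zero]
    have hb : 0 < b := by omega
    rw [slog_of_pos ha hq, slog_of_pos hb hq]
    have := ceilDiv_pos_of_pos hb hq
    exact Nat.add_le_add_right (ih (b - b ⌈/⌉ q) (by omega) (sub_ceilDiv_mono hq hab)) 1

theorem slog_sub_add_one_le {p q c : ℕ} (hp : 0 < p) (hq : 0 < q) (hc : p ⌈/⌉ q ≤ c) :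
    slog (p - c) q + 1 ≤ slog p q := by
  rw [slog_of_pos hp hq]
  exact Nat.add_le_add_right (slog_mono hq (by omega)) 1

theorem slog_le_slog_sub_add_one {p q c : ℕ} (hq : 0 < q) (hc : c ≤ p ⌈/⌉ q) :
    slog p q ≤ slog (p - c) q + 1 := by
  rcases Nat.eq_zero_or_pos p with rfl | hp
  · simp [slog_zero]
  rw [slog_of_pos hp hq]
  exact Nat.add_le_add_right (slog_mono hq (by omega)) 1

theorem tendsto_slog_atTop {q : ℕ} (hq : 2 ≤ q) :
    Filter.Tendsto (fun n => slog n q) Filter.atTop Filter.atTop := by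
  refine Filter.tendsto_atTop_atTop_of_monotone (slog_mono (by omega)) fun b => ?_
  induction b with
  | zero => exact ⟨0, Nat.zero_le _⟩
  | succ b ih =>
    obtain ⟨p, hp⟩ := ih
    refine ⟨2 * p + 2, ?_⟩
    rw [slog_of_pos (by omega) (by omega)]
    have h : (2 * p + 2) ⌈/⌉ q ≤ p + 1 := by
      rw [ceilDiv_le_iff_le_mul (by omega)]
      nlinarith
    exact Nat.add_le_add_right (hp.trans (slog_mono (by omega) (by omega))) 1

/-- If each value of `d` on `K` is at most one more than the `m`-th part of the sum of the smaller
values, then `K` has at least `slog (∑ d) (m + 1)` elements. -/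
theorem slog_sum_le_card {α : Type*} [DecidableEq α] (d : α → ℕ) (m : ℕ) (K : Finset α)
    (h : ∀ C ∈ K, m * (d C - 1) ≤ ∑ C' ∈ K with d C' < d C, d C') :
    slog (∑ C ∈ K, d C) (m + 1) ≤ K.card := by
  induction K using Finset.strongInduction with
  | _ K ih =>
    rcases K.eq_empty_or_nonempty with rfl | hK
    · simp [slog_zero]
    obtain ⟨C, hC, hmax⟩ := K.exists_max_image d hK
    have hsum := Finset.add_sum_erase K d hC
    have hrec : slog (∑ C' ∈ K.erase C, d C') (m + 1) ≤ (K.erase C).card := by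
      refine ih _ (Finset.erase_ssubset hC) fun C' hC' => (h C' (Finset.mem_of_mem_erase hC')).trans
        (Finset.sum_le_sum_of_subset fun D hD => ?_)
      rw [Finset.mem_filter] at hD ⊢
      refine ⟨Finset.mem_erase.2 ⟨?_, hD.1⟩, hD.2⟩
      rintro rfl
      exact absurd (hmax C' (Finset.mem_of_mem_erase hC')) (not_le.2 hD.2)
    have hle : ∑ C' ∈ K with d C' < d C, d C' ≤ ∑ C' ∈ K.erase C, d C' :=
      Finset.sum_le_sum_of_subset fun D hD => by
        rw [Finset.mem_filter] at hD
        exact Finset.mem_erase.2 ⟨fun e => by simp [e] at hD, hD.1⟩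
    have hC' := (h C hC).trans hle
    have hc : d C ≤ (∑ C' ∈ K, d C') ⌈/⌉ (m + 1) := by
      by_contra! hlt
      have h1 : (∑ C' ∈ K, d C') ⌈/⌉ (m + 1) ≤ d C - 1 := by omega
      rw [ceilDiv_le_iff_le_mul (by omega), ← hsum, add_mul, one_mul] at h1
      omega
    have := slog_le_slog_sub_add_one (by omega) hc
    rw [show ∑ C' ∈ K, d C' - d C = ∑ C' ∈ K.erase C, d C' by omega] at this
    have hcard := Finset.card_erase_add_one hC
    omega

namespace QuantumGraph

variable (G : QuantumGraph.{u})

theorem proj_apply_mem (C : Submodule ℂ G.V) (x : G.V) : G.proj C x ∈ C :=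
  C.starProjection_apply_mem x

theorem proj_eq_self {C : Submodule ℂ G.V} {x : G.V} (hx : x ∈ C) : G.proj C x = x :=
  Submodule.starProjection_eq_self_iff.2 hx

theorem inner_proj_left (C : Submodule ℂ G.V) (x y : G.V) :
    inner ℂ (G.proj C x) y = inner ℂ x (G.proj C y) :=
  C.inner_starProjection_left_eq_right x y

theorem IsCode.of_inner {C : Submodule ℂ G.V} (ε : G.E → ℝ)
    (h : ∀ A : G.E, ∀ x ∈ C, ∀ y ∈ C, inner ℂ x (A.1 y) = ε A * inner ℂ x y) : G.IsCode C := by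
  refine ⟨ε, fun A => LinearMap.ext fun y => ext_inner_left ℂ fun x => ?_⟩
  have := h A _ (G.proj_apply_mem C x) _ (G.proj_apply_mem C y)
  rw [inner_proj_left, inner_proj_left, G.proj_eq_self (G.proj_apply_mem C y)] at this
  simp only [Module.End.mul_apply, LinearMap.smul_apply]
  rw [this, ← Complex.coe_smul, inner_smul_right]

theorem IsCode.exists_inner_eq {C : Submodule ℂ G.V} (h : G.IsCode C) :
    ∃ ε : G.E → ℝ, ∀ A : G.E, ∀ x ∈ C, inner ℂ x (A.1 x) = (ε A : ℂ) * inner ℂ x x := by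
  obtain ⟨ε, h⟩ := h
  refine ⟨ε, fun A x hx => ?_⟩
  have := congrArg (fun T : G.V →ₗ[ℂ] G.V => inner ℂ x (T x)) (h A)
  simp only [Module.End.mul_apply, LinearMap.smul_apply] at this
  rwa [← inner_proj_left, G.proj_eq_self hx, ← Complex.coe_smul, inner_smul_right] at this

/-- A subspace contains a vector orthogonal to fewer vectors than its dimension. -/
theorem exists_unit_mem_forall_inner_eq_zero {V : Type*} [NormedAddCommGroup V]
    [InnerProductSpace ℂ V] [FiniteDimensional ℂ V] (W : Submodule ℂ V) {κ : Type*} [Fintype κ]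
    (g : κ → V) (h : Fintype.card κ < Module.finrank ℂ W) :
    ∃ x ∈ W, ‖x‖ = 1 ∧ ∀ k, inner ℂ (g k) x = 0 := by
  let f : W →ₗ[ℂ] (κ → ℂ) := LinearMap.pi fun k => (innerₛₗ ℂ (g k)) ∘ₗ W.subtype
  have hker : LinearMap.ker f ≠ ⊥ := LinearMap.ker_ne_bot_of_finrank_lt (by simpa using h)
  obtain ⟨x, hx, hx0⟩ := Submodule.exists_mem_ne_zero_of_ne_bot hker
  have hxn : ‖(x : V)‖ ≠ 0 := by simpa using hx0
  refine ⟨((‖(x : V)‖ : ℂ)⁻¹) • (x : V), W.smul_mem _ x.2, ?_, fun k => ?_⟩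
  · rw [norm_smul, norm_inv, Complex.norm_real, norm_norm, inv_mul_cancel₀ hxn]
  · have : inner ℂ (g k) (x : V) = 0 := congrFun (LinearMap.mem_ker.1 hx) k
    rw [inner_smul_right, this, mul_zero]

/-- A subspace contains many orthonormal vectors on which all edges are diagonal. -/
theorem exists_orthonormal_diagonal (W : Submodule ℂ G.V) (k : ℕ)
    (hk : k ≤ Module.finrank ℂ W ⌈/⌉ Module.finrank ℝ G.E) :
    ∃ v : Fin k → G.V, (∀ i, v i ∈ W) ∧ (∀ i, ‖v i‖ = 1) ∧
      ∀ A ∈ G.E, ∀ i j, i ≠ j → inner ℂ (v i) (A (v j)) = 0 := by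
  induction k with
  | zero => exact ⟨Fin.elim0, fun i => i.elim0, fun i => i.elim0, fun _ _ i => i.elim0⟩
  | succ k ih =>
    obtain ⟨v, hvW, hv1, hv⟩ := ih (by omega)
    let b := Module.finBasis ℝ G.E
    have hcard : Fintype.card (Fin (Module.finrank ℝ G.E) × Fin k) < Module.finrank ℂ W := by
      rcases Nat.eq_zero_or_pos (Module.finrank ℝ G.E) with h0 | h0
      · rw [h0] at hk; simp at hk
      by_contra! hle
      rw [Fintype.card_prod, Fintype.card_fin, Fintype.card_fin, ← ceilDiv_le_iff_le_mul h0] at hle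
      omega
    obtain ⟨x, hxW, hx1, hx⟩ := exists_unit_mem_forall_inner_eq_zero W
      (fun bj : Fin (Module.finrank ℝ G.E) × Fin k => (b bj.1).1 (v bj.2)) hcard
    have hx' : ∀ A ∈ G.E, ∀ j, inner ℂ (A (v j)) x = 0 := by
      intro A hA j
      have hrepr := congrArg (fun T : G.E => (T : G.V →ₗ[ℂ] G.V)) (b.sum_repr ⟨A, hA⟩)
      simp only [Submodule.coe_sum, Submodule.coe_smul] at hrepr
      rw [← hrepr, LinearMap.sum_apply, sum_inner]
      refine Finset.sum_eq_zero fun i _ => ?_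
      rw [LinearMap.smul_apply, ← Complex.coe_smul, inner_smul_left, hx (i, j), mul_zero]
    refine ⟨Fin.snoc v x, fun i => ?_, fun i => ?_, fun A hA i j => ?_⟩
    · refine Fin.lastCases ?_ (fun i => ?_) i <;> simp [hxW, hvW]
    · refine Fin.lastCases ?_ (fun i => ?_) i <;> simp [hx1, hv1]
    · have hx2 : ∀ j, inner ℂ x (A (v j)) = 0 := fun j => by
        rw [← inner_conj_symm, hx' A hA, map_zero]
      have hx3 : ∀ j, inner ℂ (v j) (A x) = 0 := fun j => by
        rw [← G.isSymmetric A hA, hx' A hA]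
      refine Fin.lastCases ?_ (fun i => ?_) i <;> refine Fin.lastCases ?_ (fun j => ?_) j <;>
        simp +contextual [hx2, hx3, hv A hA]

theorem isCode_span_range {ι : Type*} [Fintype ι] [DecidableEq ι] (f : G.E → ℝ)
    (hf : 0 < f ⟨1, G.one_mem⟩) (u : ι → G.V)
    (hu : ∀ A : G.E, ∀ s t, inner ℂ (u s) (A.1 (u t)) = if s = t then (f A : ℂ) else 0) :
    G.IsCode (Submodule.span ℂ (Set.range u)) ∧
      Module.finrank ℂ (Submodule.span ℂ (Set.range u)) = Fintype.card ι := by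
  have hf' : (f ⟨1, G.one_mem⟩ : ℂ) ≠ 0 := by exact_mod_cast hf.ne'
  have hone : ∀ s t, inner ℂ (u s) (u t) = if s = t then (f ⟨1, G.one_mem⟩ : ℂ) else 0 :=
    hu ⟨1, G.one_mem⟩
  constructor
  · refine IsCode.of_inner G (fun A => f A / f ⟨1, G.one_mem⟩) fun A x hx y hy => ?_
    induction hx using Submodule.span_induction with
    | zero => simp
    | add x x' _ _ hx hx' => rw [inner_add_left, inner_add_left, hx, hx', mul_add]
    | smul a x _ hx => rw [inner_smul_left, inner_smul_left, hx, mul_left_comm]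
    | mem x hx =>
      obtain ⟨s, rfl⟩ := hx
      induction hy using Submodule.span_induction with
      | zero => simp
      | add y y' _ _ hy hy' => rw [map_add, inner_add_right, inner_add_right, hy, hy', mul_add]
      | smul a y _ hy => rw [map_smul, inner_smul_right, inner_smul_right, hy, mul_left_comm]
      | mem y hy =>
        obtain ⟨t, rfl⟩ := hy
        rw [hu, hone]
        split_ifs
        · push_cast
          rw [div_mul_cancel₀ _ hf']
        · rw [mul_zero]
  · refine finrank_span_eq_card (linearIndependent_of_ne_zero_of_inner_eq_zero (𝕜 := ℂ) ?_ ?_)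
    · intro s hs
      have := hone s s
      rw [hs, inner_zero_left, if_pos rfl] at this
      exact hf' this.symm
    · intro s t hst
      change inner ℂ (u s) (u t) = 0
      rw [hone, if_neg hst]

/-- The **Knill–Laflamme–Viola theorem**: every subspace contains a code whose dimension is at least
the dimension of the subspace divided by the square of the dimension of the edge space. -/
theorem exists_isCode_le (hE : 0 < Module.finrank ℝ G.E) (W : Submodule ℂ G.V)
    (hW : 0 < Module.finrank ℂ W) :
    ∃ C ≤ W, G.IsCode C ∧
      Module.finrank ℂ W ⌈/⌉ (Module.finrank ℝ G.E) ^ 2 ≤ Module.finrank ℂ C := by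
  classical
  set d := Module.finrank ℝ G.E with hd
  set w := Module.finrank ℂ W with hw
  obtain ⟨k, hk⟩ : ∃ k, k = w ⌈/⌉ d := ⟨_, rfl⟩
  obtain ⟨v, hvW, hv1, hv⟩ := G.exists_orthonormal_diagonal W k hk.le
  obtain ⟨r, hr⟩ : ∃ r, w ⌈/⌉ d ^ 2 = r + 1 :=
    Nat.exists_eq_succ_of_ne_zero (ceilDiv_pos_of_pos hW (by positivity)).ne'
  have hrk : r * d < k := by
    by_contra! hle
    rw [hk, ceilDiv_le_iff_le_mul hE] at hle
    have : w ⌈/⌉ d ^ 2 ≤ r := by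
      rw [ceilDiv_le_iff_le_mul (by positivity)]
      nlinarith
    omega
  let b := Module.finBasis ℝ G.E
  obtain ⟨j, l, c, hl0, hl1, hc⟩ := exists_tverberg_partition (ι := Fin k) (β := Fin d) r
    (by simpa using hrk) (fun i a => (inner ℂ (v i) ((b a).1 (v i))).re)
  let u : Fin (r + 1) → G.V := fun s => ∑ i, if j i = s then ((√(l i) : ℝ) : ℂ) • v i else 0
  let f : G.E → ℝ := fun A => ∑ a, b.repr A a * c a
  have hdiag : ∀ A : G.E, ∀ s, ∑ i, (if j i = s then l i * (inner ℂ (v i) (A.1 (v i))).re else 0)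
      = f A := by
    intro A s
    have hrepr := congrArg (fun T : G.E => (T : G.V →ₗ[ℂ] G.V)) (b.sum_repr A)
    simp only [Submodule.coe_sum, Submodule.coe_smul] at hrepr
    have hA : ∀ i, (inner ℂ (v i) (A.1 (v i))).re =
        ∑ a, b.repr A a * (inner ℂ (v i) ((b a).1 (v i))).re := by
      intro i
      conv_lhs => rw [← hrepr]
      rw [LinearMap.sum_apply, inner_sum, Complex.re_sum]
      refine Finset.sum_congr rfl fun a _ => ?_
      rw [LinearMap.smul_apply, ← Complex.coe_smul, inner_smul_right, Complex.re_ofReal_mul]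
    simp only [f, ← hc s, hA, Finset.mul_sum]
    rw [Finset.sum_comm]
    refine Finset.sum_congr rfl fun i _ => ?_
    split_ifs
    · exact Finset.sum_congr rfl fun a _ => by ring
    · simp
  have hu : ∀ A : G.E, ∀ s t, inner ℂ (u s) (A.1 (u t)) = if s = t then (f A : ℂ) else 0 := by
    intro A s t
    simp only [u, map_sum, sum_inner, inner_sum]
    have hterm : ∀ i i', inner ℂ (if j i = s then ((√(l i) : ℝ) : ℂ) • v i else 0)
        (A.1 (if j i' = t then ((√(l i') : ℝ) : ℂ) • v i' else 0)) =
        if i' = i then (if j i = s ∧ s = t then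
          ((l i * (inner ℂ (v i) (A.1 (v i))).re : ℝ) : ℂ) else 0) else 0 := by
      intro i i'
      by_cases hi : i' = i
      · subst hi
        by_cases hs : j i' = s
        · by_cases ht : s = t
          · have hre : ((inner ℂ (v i') (A.1 (v i'))).re : ℂ) = inner ℂ (v i') (A.1 (v i')) :=
              (G.isSymmetric A.1 A.2).coe_re_inner_self_apply (v i')
            have hsq : ((√(l i') : ℝ) : ℂ) * ((√(l i') : ℝ) : ℂ) = (l i' : ℂ) := by
              rw [← Complex.ofReal_mul, Real.mul_self_sqrt (hl0 i')]
            simp only [hs, ht, if_true, and_self, map_smul, inner_smul_left, inner_smul_right,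
              Complex.conj_ofReal, Complex.ofReal_mul, hre]
            rw [← mul_assoc, hsq]
          · simp [hs, ht]
        · simp [hs]
      · rw [if_neg hi]
        split_ifs <;> simp [hv A.1 A.2 i i' (Ne.symm hi)]
    simp only [hterm, Finset.sum_ite_eq, Finset.mem_univ, if_true]
    by_cases hst : s = t
    · simp only [hst, and_true, if_true]
      rw [← hdiag A t, Complex.ofReal_sum]
      exact Finset.sum_congr rfl fun i _ => by split_ifs <;> simp
    · simp [hst]
  have hf1 : 0 < f ⟨1, G.one_mem⟩ := by
    have hone : ∀ s, ∑ i, (if j i = s then l i else 0) = f ⟨1, G.one_mem⟩ := by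
      intro s
      rw [← hdiag _ s]
      refine Finset.sum_congr rfl fun i _ => ?_
      simp [inner_self_eq_norm_sq_to_K, hv1]
    have hsum : ∑ s, ∑ i, (if j i = s then l i else 0) = 1 := by
      rw [Finset.sum_comm]
      simpa using hl1
    simp only [hone, Finset.sum_const, Finset.card_univ, Fintype.card_fin, nsmul_eq_mul] at hsum
    exact pos_of_mul_pos_right (hsum ▸ one_pos) (by positivity)
  obtain ⟨hcode, hrank⟩ := G.isCode_span_range f hf1 u hu
  refine ⟨_, ?_, hcode, by rw [hrank, hr, Fintype.card_fin]⟩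
  rw [Submodule.span_le]
  rintro _ ⟨s, rfl⟩
  refine W.sum_mem fun i _ => ?_
  split_ifs
  exacts [W.smul_mem _ (hvW i), W.zero_mem]

theorem proj_inf_orthogonal {C W : Submodule ℂ G.V} (h : C ≤ W) :
    G.proj C + G.proj (Cᗮ ⊓ W) = G.proj W := by
  refine LinearMap.ext fun x => ?_
  have hCW : G.proj C x ∈ W := h (G.proj_apply_mem C x)
  have key : G.proj W x - G.proj C x = G.proj (Cᗮ ⊓ W) x := by
    refine (Submodule.eq_starProjection_of_mem_of_inner_eq_zero (K := Cᗮ ⊓ W) ?_ ?_).symm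
    · refine ⟨fun y hy => ?_, W.sub_mem (G.proj_apply_mem W x) hCW⟩
      rw [inner_sub_right, ← inner_proj_left, ← inner_proj_left, G.proj_eq_self hy,
        G.proj_eq_self (h hy), sub_self]
    · intro y hy
      have hC : inner ℂ (G.proj C x) y = 0 := hy.1 _ (G.proj_apply_mem C x)
      rw [inner_sub_left, inner_sub_left, hC, inner_proj_left, G.proj_eq_self hy.2, sub_zero,
        sub_self]
  rw [LinearMap.add_apply, ← key, add_sub_cancel]

theorem exists_partial_coloring (hE : 0 < Module.finrank ℝ G.E) (W : Submodule ℂ G.V) :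
    ∃ K : Finset (Submodule ℂ G.V), (∀ C ∈ K, G.IsCode C ∧ C ≤ W) ∧
      ∑ C ∈ K, G.proj C = G.proj W ∧
      K.card ≤ slog (Module.finrank ℂ W) ((Module.finrank ℝ G.E) ^ 2) := by
  classical
  generalize hw : Module.finrank ℂ W = w
  induction w using Nat.strong_induction_on generalizing W with
  | _ w ih =>
    rcases Nat.eq_zero_or_pos w with rfl | hpos
    · obtain rfl := Submodule.finrank_eq_zero.1 hw
      exact ⟨∅, by simp, by simp [proj], by simp⟩
    have hE2 : 0 < Module.finrank ℝ G.E ^ 2 := by positivity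
    obtain ⟨C, hCW, hC, hdim⟩ := G.exists_isCode_le hE W (hw ▸ hpos)
    rw [hw] at hdim
    have hCpos : 0 < Module.finrank ℂ C := (ceilDiv_pos_of_pos hpos hE2).trans_le hdim
    have hadd := Submodule.finrank_add_inf_finrank_orthogonal hCW
    obtain ⟨K, hK, hKsum, hKcard⟩ := ih (w - Module.finrank ℂ C) (by omega) (Cᗮ ⊓ W) (by omega)
    have hCK : C ∉ K := by
      intro hmem
      have hbot : C = ⊥ := by
        rw [eq_bot_iff, ← C.inf_orthogonal_eq_bot]
        exact le_inf le_rfl ((hK C hmem).2.trans inf_le_left)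
      rw [hbot, finrank_bot] at hCpos
      exact lt_irrefl 0 hCpos
    refine ⟨insert C K, ?_, ?_, ?_⟩
    · intro D hD
      rcases Finset.mem_insert.1 hD with rfl | hD
      · exact ⟨hC, hCW⟩
      · exact ⟨(hK D hD).1, (hK D hD).2.trans inf_le_right⟩
    · rw [Finset.sum_insert hCK, hKsum, G.proj_inf_orthogonal hCW]
    · rw [Finset.card_insert_of_notMem hCK]
      exact (Nat.add_le_add_right hKcard 1).trans (slog_sub_add_one_le hpos hE2 hdim)

theorem proj_top : G.proj ⊤ = 1 :=
  LinearMap.ext fun _ => G.proj_eq_self Submodule.mem_top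

theorem finrank_edge_pos (h : 0 < G.order) : 0 < Module.finrank ℝ G.E := by
  have : Nontrivial G.V := Module.finrank_pos_iff.1 h
  have : Nontrivial G.E := ⟨⟨0, ⟨1, G.one_mem⟩, fun h => zero_ne_one (congrArg Subtype.val h)⟩⟩
  exact Module.finrank_pos

theorem chromaticNumber_le_slog (h : 0 < G.order) :
    G.chromaticNumber ≤ (slog G.order ((G.valence + 1) ^ 2) : ℕ∞) := by
  have hE := G.finrank_edge_pos h
  obtain ⟨K, hK, hsum, hcard⟩ := G.exists_partial_coloring hE ⊤
  rw [finrank_top] at hcard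
  have hK' : G.IsColoring K := ⟨fun C hC => (hK C hC).1, hsum.trans G.proj_top⟩
  have hle : G.chromaticNumber ≤ K.card := sInf_le ⟨K, hK', rfl⟩
  refine hle.trans ?_
  rw [valence, Nat.sub_add_cancel hE]
  exact_mod_cast hcard

end QuantumGraph

namespace QuantumGraph

variable {G : QuantumGraph.{u}} {K : Finset (Submodule ℂ G.V)}

theorem finrank_eq_trace_proj (C : Submodule ℂ G.V) :
    LinearMap.trace ℂ G.V (G.proj C) = Module.finrank ℂ C :=
  LinearMap.IsProj.trace ⟨G.proj_apply_mem C, fun _ => G.proj_eq_self⟩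

theorem IsColoring.sum_finrank (hK : G.IsColoring K) :
    ∑ C ∈ K, Module.finrank ℂ C = G.order := by
  have := congrArg (LinearMap.trace ℂ G.V) hK.2
  simp only [map_sum, finrank_eq_trace_proj, LinearMap.trace_one] at this
  exact_mod_cast this

theorem IsColoring.sum_proj_apply (hK : G.IsColoring K) (x : G.V) :
    ∑ C ∈ K, G.proj C x = x := by
  rw [← LinearMap.sum_apply, hK.2, Module.End.one_apply]

theorem IsColoring.sum_norm_sq (hK : G.IsColoring K) (x : G.V) :
    ∑ C ∈ K, ‖G.proj C x‖ ^ 2 = ‖x‖ ^ 2 := by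
  have h : ∀ C : Submodule ℂ G.V, ‖G.proj C x‖ ^ 2 = (inner ℂ x (G.proj C x)).re := by
    intro C
    rw [← G.proj_eq_self (G.proj_apply_mem C x), ← inner_proj_left,
      G.proj_eq_self (G.proj_apply_mem C x)]
    exact (inner_self_eq_norm_sq (𝕜 := ℂ) _).symm
  simp only [h]
  rw [← Complex.re_sum, ← inner_sum, hK.sum_proj_apply]
  exact inner_self_eq_norm_sq (𝕜 := ℂ) x

/-- The weights `M ^ (n - i / m)`, `M = n * m + 1`, of the basis vectors. -/
def weight (n m i : ℕ) : ℝ := (n * m + 1 : ℝ) ^ (n - i / m)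

theorem weight_nonneg (n m i : ℕ) : 0 ≤ weight n m i := by
  unfold weight; positivity

/-- An operator is a weighted block if its quadratic form is that of the diagonal matrix that has
the weights as entries at the indices congruent to `l` modulo `m` and zeros elsewhere. -/
def IsWeightedBlock {V : Type*} [NormedAddCommGroup V] [InnerProductSpace ℂ V] {n : ℕ}
    (e : OrthonormalBasis (Fin n) ℂ V) (m l : ℕ) (A : V →ₗ[ℂ] V) : Prop :=
  ∀ x, (inner ℂ x (A x)).re =
    ∑ i : Fin n, if (i : ℕ) % m = l then weight n m i * ‖inner ℂ (e i) x‖ ^ 2 else 0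

theorem IsCode.inner_weightedBlock_le {n m l : ℕ} (e : OrthonormalBasis (Fin n) ℂ G.V)
    {A : G.V →ₗ[ℂ] G.V} (hA : A ∈ G.E) (hb : IsWeightedBlock e m l A) {C : Submodule ℂ G.V}
    (hC : G.IsCode C) {c : ℕ} (hc : c < Module.finrank ℂ C) {y : G.V} (hy : y ∈ C) :
    (inner ℂ y (A y)).re ≤ (n * m + 1 : ℝ) ^ (n - c) * ‖y‖ ^ 2 := by
  obtain ⟨ε, hε⟩ := hC.exists_inner_eq
  have hε' : ∀ x ∈ C, (inner ℂ x (A x)).re = ε ⟨A, hA⟩ * ‖x‖ ^ 2 := by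
    intro x hx
    have h := hε ⟨A, hA⟩ x hx
    dsimp only at h
    rw [h, Complex.re_ofReal_mul]
    exact congrArg _ (inner_self_eq_norm_sq (𝕜 := ℂ) x)
  have hcard : Fintype.card {i : Fin n // (i : ℕ) % m = l ∧ (i : ℕ) / m < c} ≤ c := by
    have := Fintype.card_le_of_injective
      (fun i : {i : Fin n // (i : ℕ) % m = l ∧ (i : ℕ) / m < c} =>
        (⟨(i.1 : ℕ) / m, i.2.2⟩ : Fin c)) (fun i i' h => by
          have h1 := Nat.div_add_mod (i.1 : ℕ) m
          have h2 := Nat.div_add_mod (i'.1 : ℕ) m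
          simp only [Fin.mk.injEq] at h
          rw [i.2.1, h] at h1
          rw [i'.2.1] at h2
          exact Subtype.ext (Fin.ext (by omega)))
    simpa using this
  obtain ⟨x, hxC, hx1, hx⟩ := exists_unit_mem_forall_inner_eq_zero C
    (fun i : {i : Fin n // (i : ℕ) % m = l ∧ (i : ℕ) / m < c} => e i.1) (by omega)
  have hle : ε ⟨A, hA⟩ ≤ (n * m + 1 : ℝ) ^ (n - c) := by
    have h := hε' x hxC
    rw [hx1, one_pow, mul_one, hb x] at h
    rw [← h]
    calc _ ≤ ∑ i : Fin n, (n * m + 1 : ℝ) ^ (n - c) * ‖inner ℂ (e i) x‖ ^ 2 := by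
          refine Finset.sum_le_sum fun i _ => ?_
          split_ifs with hi
          · by_cases hic : (i : ℕ) / m < c
            · rw [hx ⟨i, hi, hic⟩]; simp
            · refine mul_le_mul_of_nonneg_right ?_ (by positivity)
              refine pow_le_pow_right₀ ?_ (by omega)
              have : (0 : ℝ) ≤ n * m := by positivity
              linarith
          · positivity
      _ = (n * m + 1 : ℝ) ^ (n - c) := by
          rw [← Finset.mul_sum, e.sum_sq_norm_inner_right, hx1]; simp
  rw [hε' y hy]
  exact mul_le_mul_of_nonneg_right hle (by positivity)

theorem IsColoring.mul_finrank_sub_one_le {n m : ℕ} (e : OrthonormalBasis (Fin n) ℂ G.V)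
    (A : Fin m → G.V →ₗ[ℂ] G.V) (hA : ∀ l, A l ∈ G.E)
    (hb : ∀ l : Fin m, IsWeightedBlock e m l (A l)) (hK : G.IsColoring K)
    {C : Submodule ℂ G.V} (hC : C ∈ K) :
    m * (Module.finrank ℂ C - 1) ≤
      ∑ C' ∈ K.filter (fun C' : Submodule ℂ G.V => Module.finrank ℂ C' < Module.finrank ℂ C),
        Module.finrank ℂ C' := by
  classical
  by_contra! hlt
  have hn : Module.finrank ℂ G.V = n := by
    simpa using Module.finrank_eq_card_basis e.toBasis
  set c := Module.finrank ℂ C with hc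
  set D := ∑ C' ∈ K.filter (fun C' : Submodule ℂ G.V => Module.finrank ℂ C' < c),
    Module.finrank ℂ C' with hD
  have hm : 0 < m := Nat.pos_of_mul_pos_right (by omega : 0 < m * (c - 1))
  have hc2 : 2 ≤ c := by
    by_contra! h
    have : c - 1 = 0 := by omega
    simp [this] at hlt
  have hsplit : D + ∑ C' ∈ K.filter (fun C' : Submodule ℂ G.V => ¬ Module.finrank ℂ C' < c),
      Module.finrank ℂ C' = n := by
    rw [Finset.sum_filter_add_sum_filter_not, hK.sum_finrank, order, hn]
  set L := K.filter fun C' : Submodule ℂ G.V => ¬ Module.finrank ℂ C' < c with hL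
  have hCL : C ∈ L := Finset.mem_filter.2 ⟨hC, lt_irrefl _⟩
  have hcL : c ≤ ∑ C' ∈ L, Module.finrank ℂ C' :=
    Finset.single_le_sum (f := fun C' : Submodule ℂ G.V => Module.finrank ℂ C')
      (fun _ _ => Nat.zero_le _) hCL
  have hLn : L.card ≤ n := by
    have : L.card • 1 ≤ ∑ C' ∈ L, Module.finrank ℂ C' :=
      Finset.card_nsmul_le_sum L _ 1 fun C' hC' => by
        have := (Finset.mem_filter.1 hC').2
        omega
    rw [smul_eq_mul, mul_one] at this
    omega
  -- A nonzero vector supported on the heavy basis vectors that the small codes do not see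
  obtain ⟨x, hx0, hxsmall, hxe⟩ : ∃ x : G.V, x ≠ 0 ∧
      (∀ C' ∈ K, Module.finrank ℂ C' < c → G.proj C' x = 0) ∧
      ∀ i : Fin n, m * (c - 1) ≤ (i : ℕ) → inner ℂ (e i) x = 0 := by
    let S := K.filter fun C' : Submodule ℂ G.V => Module.finrank ℂ C' < c
    let f : G.V →ₗ[ℂ] ((C' : S) → (C'.1 : Submodule ℂ G.V)) ×
        ({i : Fin n // m * (c - 1) ≤ (i : ℕ)} → ℂ) :=
      (LinearMap.pi fun C' => (G.proj C'.1).codRestrict C'.1 (G.proj_apply_mem C'.1)).prod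
        (LinearMap.pi fun i => innerₛₗ ℂ (e i.1))
    have hcard : Fintype.card {i : Fin n // m * (c - 1) ≤ (i : ℕ)} ≤ n - m * (c - 1) := by
      have := Fintype.card_le_of_injective
        (fun i : {i : Fin n // m * (c - 1) ≤ (i : ℕ)} =>
          (⟨(i.1 : ℕ) - m * (c - 1), by have := i.1.2; have := i.2; omega⟩ : Fin (n - m * (c - 1))))
        (fun i i' h => by
          simp only [Fin.mk.injEq] at h
          have := i.2
          have := i'.2
          exact Subtype.ext (Fin.ext (by omega)))
      simpa using this
    have hfin : Module.finrank ℂ (((C' : S) → (C'.1 : Submodule ℂ G.V)) ×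
        ({i : Fin n // m * (c - 1) ≤ (i : ℕ)} → ℂ)) < Module.finrank ℂ G.V := by
      rw [Module.finrank_prod, Module.finrank_pi_fintype, Module.finrank_fintype_fun_eq_card,
        Finset.sum_coe_sort S fun C' => Module.finrank ℂ C', hn]
      change D + _ < n
      omega
    obtain ⟨x, hx, hx0⟩ := Submodule.exists_mem_ne_zero_of_ne_bot
      (LinearMap.ker_ne_bot_of_finrank_lt (f := f) hfin)
    have hx' := Prod.mk.inj (LinearMap.mem_ker.1 hx : f x = (0, 0))
    refine ⟨x, hx0, fun C' hC' hlt => ?_, fun i hi => congrFun hx'.2 ⟨i, hi⟩⟩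
    exact congrArg Subtype.val (congrFun hx'.1 ⟨C', Finset.mem_filter.2 ⟨hC', hlt⟩⟩)
  have hxL : ∑ C' ∈ L, G.proj C' x = x := by
    conv_rhs => rw [← hK.sum_proj_apply x]
    refine Finset.sum_subset (Finset.filter_subset _ _) fun C' hC' hnot => hxsmall C' hC' ?_
    by_contra h
    exact hnot (Finset.mem_filter.2 ⟨hC', h⟩)
  have hxLn : ∑ C' ∈ L, ‖G.proj C' x‖ ^ 2 ≤ ‖x‖ ^ 2 := by
    rw [← hK.sum_norm_sq x]
    exact Finset.sum_le_sum_of_subset_of_nonneg (Finset.filter_subset _ _)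
      fun _ _ _ => by positivity
  set B : ℝ := (n * m + 1 : ℝ) ^ (n - (c - 1)) with hB
  have hM : (1 : ℝ) ≤ n * m + 1 := by
    have : (0 : ℝ) ≤ n * m := by positivity
    linarith
  have hBpos : 0 < B := by positivity
  let q : G.V → ℝ := fun y => ∑ i : Fin n, weight n m i * ‖inner ℂ (e i) y‖ ^ 2
  have hq : ∀ y, q y = ∑ l, (inner ℂ y (A l y)).re := by
    intro y
    simp only [q, hb _ y]
    rw [Finset.sum_comm]
    refine Finset.sum_congr rfl fun i _ => ?_
    rw [Finset.sum_eq_single (⟨(i : ℕ) % m, Nat.mod_lt _ hm⟩ : Fin m)]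
    · simp
    · intro l _ hl
      exact if_neg fun h => hl (Fin.ext h.symm)
    · simp
  have hqL : ∀ C' ∈ L, q (G.proj C' x) ≤ m * B * ‖G.proj C' x‖ ^ 2 := by
    intro C' hC'
    obtain ⟨hC'K, hC'c⟩ := Finset.mem_filter.1 hC'
    rw [hq]
    refine (Finset.sum_le_sum fun l _ => (hK.1 C' hC'K).inner_weightedBlock_le e (hA l) (hb l)
      (by omega : c - 1 < Module.finrank ℂ C') (G.proj_apply_mem C' x)).trans ?_
    rw [Finset.sum_const, Finset.card_univ, Fintype.card_fin, nsmul_eq_mul, mul_assoc]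
  have hqx : q x ≤ L.card * ∑ C' ∈ L, q (G.proj C' x) := by
    simp only [q]
    rw [Finset.sum_comm, Finset.mul_sum]
    refine Finset.sum_le_sum fun i _ => ?_
    rw [← Finset.mul_sum, mul_left_comm]
    refine mul_le_mul_of_nonneg_left ?_ (weight_nonneg n m i)
    conv_lhs => rw [← hxL]
    rw [inner_sum]
    refine (pow_le_pow_left₀ (norm_nonneg _) (norm_sum_le _ _) 2).trans ?_
    exact sq_sum_le_card_mul_sum_sq
  have hlow : (n * m + 1) * B * ‖x‖ ^ 2 ≤ q x := by
    rw [← e.sum_sq_norm_inner_right x, Finset.mul_sum]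
    refine Finset.sum_le_sum fun i _ => ?_
    by_cases hi : m * (c - 1) ≤ (i : ℕ)
    · simp [hxe i hi]
    · refine mul_le_mul_of_nonneg_right ?_ (by positivity)
      rw [hB, ← pow_succ']
      refine pow_le_pow_right₀ hM ?_
      have : (i : ℕ) / m < c - 1 := by
        rw [Nat.div_lt_iff_lt_mul hm, mul_comm]; omega
      omega
  have hup : q x ≤ n * (m * B * ‖x‖ ^ 2) := calc
    q x ≤ L.card * ∑ C' ∈ L, q (G.proj C' x) := hqx
    _ ≤ L.card * ∑ C' ∈ L, m * B * ‖G.proj C' x‖ ^ 2 := by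
        gcongr with C' hC'
        exact hqL C' hC'
    _ = L.card * (m * B * ∑ C' ∈ L, ‖G.proj C' x‖ ^ 2) := by
        rw [← Finset.mul_sum L]
    _ ≤ n * (m * B * ‖x‖ ^ 2) := by gcongr
  have hxpos : 0 < B * ‖x‖ ^ 2 := by
    have := norm_pos_iff.2 hx0
    positivity
  nlinarith

theorem slog_le_chromaticNumber {n m : ℕ} (e : OrthonormalBasis (Fin n) ℂ G.V)
    (A : Fin m → G.V →ₗ[ℂ] G.V) (hA : ∀ l, A l ∈ G.E)
    (hb : ∀ l : Fin m, IsWeightedBlock e m l (A l)) :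
    (slog n (m + 1) : ℕ∞) ≤ G.chromaticNumber := by
  classical
  refine le_sInf ?_
  rintro _ ⟨K, hK, rfl⟩
  have hn : G.order = n := by
    rw [order]
    simpa using Module.finrank_eq_card_basis e.toBasis
  have := slog_sum_le_card (fun C : Submodule ℂ G.V => Module.finrank ℂ C) m K
    fun C hC => hK.mul_finrank_sub_one_le e A hA hb hC
  rw [hK.sum_finrank, hn] at this
  exact_mod_cast this

end QuantumGraph

section Construction

variable {V : Type*} [NormedAddCommGroup V] [InnerProductSpace ℂ V]

/-- The operator that is diagonal in a given orthonormal basis, with given real entries. -/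
noncomputable def diagonalOperator {n : ℕ} (e : OrthonormalBasis (Fin n) ℂ V) (a : Fin n → ℝ) :
    V →ₗ[ℂ] V :=
  ∑ i, (a i : ℂ) • (innerₛₗ ℂ (e i)).smulRight (e i)

theorem inner_diagonalOperator {n : ℕ} (e : OrthonormalBasis (Fin n) ℂ V) (a : Fin n → ℝ)
    (x y : V) : inner ℂ x (diagonalOperator e a y) =
      ∑ i, (a i : ℂ) * (inner ℂ (e i) y * inner ℂ x (e i)) := by
  simp [diagonalOperator, LinearMap.sum_apply]

theorem diagonalOperator_isSymmetric {n : ℕ} (e : OrthonormalBasis (Fin n) ℂ V) (a : Fin n → ℝ) :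
    (diagonalOperator e a).IsSymmetric := by
  intro x y
  rw [← inner_conj_symm, inner_diagonalOperator, inner_diagonalOperator, map_sum]
  refine Finset.sum_congr rfl fun i _ => ?_
  simp only [map_mul, Complex.conj_ofReal, inner_conj_symm]
  ring

theorem re_inner_diagonalOperator_self {n : ℕ} (e : OrthonormalBasis (Fin n) ℂ V) (a : Fin n → ℝ)
    (x : V) : (inner ℂ x (diagonalOperator e a x)).re = ∑ i, a i * ‖inner ℂ (e i) x‖ ^ 2 := by
  rw [inner_diagonalOperator, Complex.re_sum]
  refine Finset.sum_congr rfl fun i _ => ?_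
  rw [Complex.re_ofReal_mul, ← inner_conj_symm x (e i), Complex.mul_conj, Complex.ofReal_re,
    Complex.normSq_eq_norm_sq]

/-- The real vector space of symmetric operators. -/
def symmetricOperators (V : Type*) [NormedAddCommGroup V] [InnerProductSpace ℂ V] :
    Submodule ℝ (V →ₗ[ℂ] V) where
  carrier := {A | A.IsSymmetric}
  add_mem' hA hB := hA.add hB
  zero_mem' := LinearMap.IsSymmetric.zero
  smul_mem' r A hA x y := by
    simp only [LinearMap.smul_apply, ← Complex.coe_smul, inner_smul_left, inner_smul_right,
      Complex.conj_ofReal, hA x y]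

theorem sq_finrank_le_finrank_symmetricOperators [FiniteDimensional ℂ V] :
    Module.finrank ℂ V ^ 2 ≤ Module.finrank ℝ (symmetricOperators V) := by
  have : FiniteDimensional ℝ (V →ₗ[ℂ] V) := FiniteDimensional.complexToReal _
  let f : (symmetricOperators V × symmetricOperators V) →ₗ[ℝ] (V →ₗ[ℂ] V) :=
    (symmetricOperators V).subtype.coprod
      (Complex.I • (symmetricOperators V).subtype)
  have hf : Function.Surjective f := by
    intro T
    have h1 : ((2 : ℂ)⁻¹ • (T + T.adjoint)).IsSymmetric := fun x y => by
      simp only [LinearMap.smul_apply, LinearMap.add_apply, inner_smul_left, inner_smul_right,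
        inner_add_left, inner_add_right, LinearMap.adjoint_inner_left,
        LinearMap.adjoint_inner_right, map_inv₀, map_ofNat]
      ring
    have h2 : ((-Complex.I * (2 : ℂ)⁻¹) • (T - T.adjoint)).IsSymmetric := fun x y => by
      simp only [LinearMap.smul_apply, LinearMap.sub_apply, inner_smul_left, inner_smul_right,
        inner_sub_left, inner_sub_right, LinearMap.adjoint_inner_left,
        LinearMap.adjoint_inner_right, map_inv₀, map_ofNat, map_mul, map_neg, Complex.conj_I]
      ring
    refine ⟨(⟨_, h1⟩, ⟨_, h2⟩), ?_⟩
    have hI : Complex.I * (-Complex.I * (2 : ℂ)⁻¹) = (2 : ℂ)⁻¹ := by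
      rw [← mul_assoc, mul_neg, Complex.I_mul_I, neg_neg, one_mul]
    simp only [f, LinearMap.coprod_apply, LinearMap.smul_apply, Submodule.subtype_apply]
    rw [smul_smul, hI, ← smul_add, add_add_sub_cancel, ← two_smul ℂ T, smul_smul,
      inv_mul_cancel₀ two_ne_zero, one_smul]
  have h1 := LinearMap.finrank_le_finrank_of_surjective hf
  rw [Module.finrank_prod, finrank_real_of_complex, Module.finrank_linearMap] at h1
  nlinarith

theorem exists_le_le_finrank_eq {W : Type*} [AddCommGroup W] [Module ℝ W] [FiniteDimensional ℝ W]
    {E H : Submodule ℝ W} (hEH : E ≤ H) {k : ℕ} (hE : Module.finrank ℝ E ≤ k)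
    (hH : k ≤ Module.finrank ℝ H) : ∃ F, E ≤ F ∧ F ≤ H ∧ Module.finrank ℝ F = k := by
  induction k, hE using Nat.le_induction with
  | base => exact ⟨E, le_rfl, hEH, rfl⟩
  | succ k _ ih =>
    obtain ⟨F, hEF, hFH, hF⟩ := ih (by omega)
    have hlt : F < H := lt_of_le_of_ne hFH fun h => by rw [h] at hF; omega
    obtain ⟨x, hxH, hxF⟩ := SetLike.exists_of_lt hlt
    refine ⟨F ⊔ Submodule.span ℝ {x}, hEF.trans le_sup_left,
      sup_le hFH ((Submodule.span_singleton_le_iff_mem _ _).2 hxH), ?_⟩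
    rw [Submodule.finrank_sup_span_singleton hxF, hF]

end Construction

/-- There is a quantum graph of every admissible order and valence whose chromatic number is bounded
below by the step logarithm. -/
theorem exists_slog_le_chromaticNumber (n m : ℕ) (h : m + 1 ≤ n ^ 2) :
    ∃ G : QuantumGraph.{u}, G.order = n ∧ G.valence = m ∧
      (slog n (m + 1) : ℕ∞) ≤ G.chromaticNumber := by
  let V : Type u := EuclideanSpace ℂ (ULift.{u} (Fin n))
  have hV : Module.finrank ℂ V = n := by simp [V]
  let e : OrthonormalBasis (Fin n) ℂ V := (stdOrthonormalBasis ℂ V).reindex (finCongr hV)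
  let A : Fin m → V →ₗ[ℂ] V := fun l => diagonalOperator e fun i =>
    if (i : ℕ) % m = l then QuantumGraph.weight n m i else 0
  have : FiniteDimensional ℝ (V →ₗ[ℂ] V) := FiniteDimensional.complexToReal _
  let E₀ : Submodule ℝ (V →ₗ[ℂ] V) := Submodule.span ℝ (Set.range (Option.elim · 1 A))
  have hE₀ : E₀ ≤ symmetricOperators V := by
    rw [Submodule.span_le]
    rintro _ ⟨_ | l, rfl⟩
    exacts [LinearMap.IsSymmetric.one, diagonalOperator_isSymmetric _ _]
  have hcard : Module.finrank ℝ E₀ ≤ m + 1 := by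
    simpa [Set.finrank, E₀] using
      finrank_range_le_card (R := ℝ) (Option.elim · 1 A : Option (Fin m) → V →ₗ[ℂ] V)
  have hsq := sq_finrank_le_finrank_symmetricOperators (V := V)
  rw [hV] at hsq
  obtain ⟨E, hE₀E, hE, hdim⟩ := exists_le_le_finrank_eq hE₀ hcard (h.trans hsq)
  let G : QuantumGraph.{u} :=
    { V := V
      E := E
      isSymmetric := fun A hA => hE hA
      one_mem := hE₀E (Submodule.subset_span ⟨none, rfl⟩) }
  refine ⟨G, hV, by simp [QuantumGraph.valence, G, hdim],
    QuantumGraph.slog_le_chromaticNumber (G := G) e A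
      (fun l => hE₀E (Submodule.subset_span ⟨some l, rfl⟩)) fun l x => ?_⟩
  refine (re_inner_diagonalOperator_self e _ x).trans (Finset.sum_congr rfl fun i _ => ?_)
  split_ifs
  exacts [rfl, zero_mul _]

theorem theorem2 :
    (∀ n m : ℕ, m + 1 ≤ n ^ 2 →
      IsGreatest (chromaticNumbers.{u} n m) (maxChromaticNumber.{u} n m) ∧
      (slog n (m + 1) : ℕ∞) ≤ maxChromaticNumber.{u} n m ∧
      maxChromaticNumber.{u} n m ≤ (slog n ((m + 1) ^ 2) : ℕ∞)) ∧
    (∀ m : ℕ, 1 ≤ m → Filter.Tendsto (fun n => slog n (m + 1)) Filter.atTop Filter.atTop) ∧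
    (∀ m : ℕ, 1 ≤ m → ∀ b : ℕ, ∃ G : QuantumGraph.{u},
      G.valence = m ∧ (b : ℕ∞) < G.chromaticNumber) ∧
    ¬ ∃ f : ℕ → ℕ, ∀ G : QuantumGraph.{u}, G.chromaticNumber ≤ (f G.valence : ℕ∞) := by
  have htendsto : ∀ m : ℕ, 1 ≤ m →
      Filter.Tendsto (fun n => slog n (m + 1)) Filter.atTop Filter.atTop :=
    fun m hm => tendsto_slog_atTop (by omega)
  have hunbounded : ∀ m : ℕ, 1 ≤ m → ∀ b : ℕ, ∃ G : QuantumGraph.{u},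
      G.valence = m ∧ (b : ℕ∞) < G.chromaticNumber := by
    intro m hm b
    obtain ⟨n, hb, hn⟩ := (((htendsto m hm).eventually_gt_atTop b).and
      (Filter.eventually_ge_atTop (m + 1))).exists
    obtain ⟨G, -, hG, hχ⟩ := exists_slog_le_chromaticNumber.{u} n m (by nlinarith)
    exact ⟨G, hG, lt_of_lt_of_le (by exact_mod_cast hb) hχ⟩
  refine ⟨fun n m h => ?_, htendsto, hunbounded, ?_⟩
  · have hn : 0 < n := Nat.pos_of_ne_zero (by rintro rfl; simp at h)
    obtain ⟨G, hGn, hGm, hG⟩ := exists_slog_le_chromaticNumber.{u} n m h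
    have hmem : G.chromaticNumber ∈ chromaticNumbers.{u} n m := ⟨G, hGn, hGm, rfl⟩
    have hle : maxChromaticNumber.{u} n m ≤ (slog n ((m + 1) ^ 2) : ℕ∞) := by
      refine sSup_le ?_
      rintro _ ⟨G', rfl, rfl, rfl⟩
      exact G'.chromaticNumber_le_slog hn
    have : Nonempty (chromaticNumbers.{u} n m) := ⟨⟨_, hmem⟩⟩
    exact ⟨⟨ENat.sSup_mem_of_nonempty_of_lt_top (hle.trans_lt (ENat.natCast_lt_top _)),
      fun _ => le_sSup⟩, hG.trans (le_sSup hmem), hle⟩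
  · rintro ⟨f, hf⟩
    obtain ⟨G, hG, hlt⟩ := hunbounded 1 le_rfl (f 1)
    exact absurd (hf G) (not_le.2 (hG ▸ hlt))
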